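/- A rooted plane tree consists of a root together with a finite (possibly empty) ordered sequence of rooted plane trees attached to it; two rooted plane trees are isomorphic if there is an isomorphism of rooted trees between them that respects the left-to-right order of the children of every vertex. A plane 1-2 tree is a rooted plane tree in which every vertex has at most two children (a vertex with a single child does not distinguish left from right). A tree is a hipster tree if, for any two distinct siblings $u,v$, the subtrees consisting of all vertices weakly below $u$ and weakly below $v$, respectively, are not isomorphic. For $n\ge 1$ let $h_n$ be the number of plane 1-2 hipster trees with $n$ vertices (counted up to isomorphism of rooted plane trees), and let $h_0=1$ (the empty tree). Then the formal power series $H(x)=\sum_{n\ge 0}h_nx^n$ satisfies $$H(x)=x\left(H(x)^2-H(x)-H(x^2)+2\right)+1,$$ and the exponential growth rate $\rho=\lim_{n\to\infty}h_n^{1/n}$ exists and satisfies $$2.824486\le\rho\le 2.854882 .$$ -/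

import Mathlib

/-- A (nonempty) rooted plane tree: a root together with the finite sequence, in left-to-right
order, of the rooted plane trees hanging from it. Two rooted plane trees are isomorphic (as rooted
plane trees, that is, respecting the order of the children) if and only if they are equal as
elements of this type. -/
inductive PlaneTree : Type
  | node (children : List PlaneTree) : PlaneTree

namespace PlaneTree

/-- The sequence of subtrees hanging from the root. -/
def children : PlaneTree → List PlaneTree
  | node ts => ts

/-- The number of vertices. -/
def numVertices : PlaneTree → ℕ
  | node ts => 1 + (ts.attach.map fun t => numVertices t.1).sum
decreasing_by
  have h := List.sizeOf_lt_of_mem t.2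
  simp only [node.sizeOf_spec]
  omega

/-- `IsSubtreeOf S T`: `S` is the subtree `S_v` of all vertices weakly below `v`, for some
vertex `v` of `T`. -/
inductive IsSubtreeOf (S : PlaneTree) : PlaneTree → Prop
  | refl : IsSubtreeOf S S
  | descend {T : PlaneTree} {ts : List PlaneTree} :
      T ∈ ts → IsSubtreeOf S T → IsSubtreeOf S (node ts)

/-- A plane 1-2 tree: every vertex has at most two children. -/
def IsOneTwo (T : PlaneTree) : Prop :=
  ∀ S : PlaneTree, IsSubtreeOf S T → S.children.length ≤ 2

/-- A hipster tree: at every vertex, the subtrees hanging from two different children (that is,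
at two different positions in the sequence of children) are not isomorphic. -/
def IsHipster (T : PlaneTree) : Prop :=
  ∀ S : PlaneTree, IsSubtreeOf S T → S.children.Pairwise (fun A B => A ≠ B)

end PlaneTree

/-- The number `h_n` of plane 1-2 hipster trees with `n` vertices. The empty tree is counted as the
only tree with `0` vertices. -/
noncomputable def hipsterCount : ℕ → ℕ
  | 0 => 1
  | n + 1 => Set.ncard {T : PlaneTree | T.numVertices = n + 1 ∧ T.IsOneTwo ∧ T.IsHipster}

/-- The generating function `H(x) = ∑ h_n x^n`. -/
noncomputable def hipsterSeries : PowerSeries ℤ :=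
  PowerSeries.mk fun n => (hipsterCount n : ℤ)

/-! Let `T = H - 1` count the nonempty trees. The root has no child, one child, or an ordered pair
of unequal children, and equal pairs are counted by `T(x²)`; hence `T = x(1 + T + T² - T(x²))`
(`numHipsters_succ`). For fixed `x > 0` and `τ = T(x²) ≤ 1`, the value `y = T(x)` must solve `y² -
(1/x - 1)y + 1 - τ = 0`, which needs `1/x ≥ 1 + 2√(1 - τ)` when `x < 1`. An upper bound on `τ`
therefore forces divergence at `x = 1/2.824486` (`not_summable_numHipsters`), while a lower bound on
`τ` gives a majorant at `x = 1/2.854882` (`partialSum_le`). The limit exists by Fekete's lemma,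
since the counts are supermultiplicative up to a shift (`numHipsters_mul_le`). -/

namespace PlaneTree

/-! ### Decomposition at the root and the recurrence. -/

theorem numVertices_node (ts : List PlaneTree) :
    (node ts).numVertices = 1 + (ts.map numVertices).sum := by
  simp [numVertices]

theorem isSubtreeOf_node {S : PlaneTree} {ts : List PlaneTree} :
    IsSubtreeOf S (node ts) ↔ S = node ts ∨ ∃ T ∈ ts, IsSubtreeOf S T := by
  constructor
  · rintro (_ | ⟨hT, h⟩)
    · exact Or.inl rfl
    · exact Or.inr ⟨_, hT, h⟩
  · rintro (rfl | ⟨T, hT, h⟩)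
    · exact .refl
    · exact .descend hT h

/-- A plane 1-2 hipster tree. -/
def IsOneTwoHipster (T : PlaneTree) : Prop := T.IsOneTwo ∧ T.IsHipster

theorem isOneTwoHipster_node {ts : List PlaneTree} :
    (node ts).IsOneTwoHipster ↔
      ts.length ≤ 2 ∧ ts.Pairwise (fun A B => A ≠ B) ∧ ∀ T ∈ ts, T.IsOneTwoHipster := by
  simp only [IsOneTwoHipster, IsOneTwo, IsHipster, isSubtreeOf_node]
  constructor
  · rintro ⟨h, h'⟩
    exact ⟨h _ (.inl rfl), h' _ (.inl rfl),
      fun T hT => ⟨fun S hS => h S (.inr ⟨T, hT, hS⟩), fun S hS => h' S (.inr ⟨T, hT, hS⟩)⟩⟩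
  · rintro ⟨h, h', h''⟩
    constructor
    · rintro S (rfl | ⟨T, hT, hS⟩)
      exacts [h, (h'' T hT).1 S hS]
    · rintro S (rfl | ⟨T, hT, hS⟩)
      exacts [h', (h'' T hT).2 S hS]

theorem numVertices_pos (T : PlaneTree) : 0 < T.numVertices := by
  cases T with
  | node ts => rw [numVertices_node]; omega

/-- The 1-2 hipster trees according to the number of children of the root. -/
theorem isOneTwoHipster_iff {T : PlaneTree} :
    T.IsOneTwoHipster ↔ T = node [] ∨ (∃ A, A.IsOneTwoHipster ∧ T = node [A]) ∨
      ∃ A B, A.IsOneTwoHipster ∧ B.IsOneTwoHipster ∧ A ≠ B ∧ T = node [A, B] := by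
  constructor
  · cases T with
    | node ts =>
      rw [isOneTwoHipster_node]
      rintro ⟨h, h', h''⟩
      match ts, h with
      | [], _ => exact .inl rfl
      | [A], _ => exact .inr (.inl ⟨A, by simpa using h'', rfl⟩)
      | [A, B], _ =>
        exact .inr (.inr ⟨A, B, h'' A (by simp), h'' B (by simp), by simpa using h', rfl⟩)
  · rintro (rfl | ⟨A, hA, rfl⟩ | ⟨A, B, hA, hB, hAB, rfl⟩)
    · simp [isOneTwoHipster_node]
    · simp [isOneTwoHipster_node, hA]
    · simp [isOneTwoHipster_node, hA, hB, hAB]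

theorem finite_isOneTwoHipster_le (n : ℕ) :
    {T : PlaneTree | T.numVertices ≤ n ∧ T.IsOneTwoHipster}.Finite := by
  induction n with
  | zero =>
    convert Set.finite_empty
    ext T
    have := T.numVertices_pos
    simp
    omega
  | succ n ih =>
    refine (((Set.finite_singleton (node [])).union (ih.image fun A => node [A])).union
      (ih.image2 (fun A B => node [A, B]) ih)).subset ?_
    rintro T ⟨hn, hT⟩
    rcases isOneTwoHipster_iff.1 hT with rfl | ⟨A, hA, rfl⟩ | ⟨A, B, hA, hB, -, rfl⟩
    · exact .inl (.inl rfl)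
    · refine .inl (.inr ⟨A, ⟨?_, hA⟩, rfl⟩)
      simp [numVertices_node] at hn
      omega
    · simp [numVertices_node] at hn
      exact .inr ⟨A, ⟨by omega, hA⟩, B, ⟨by omega, hB⟩, rfl⟩

theorem finite_isOneTwoHipster (n : ℕ) :
    {T : PlaneTree | T.numVertices = n ∧ T.IsOneTwoHipster}.Finite :=
  (finite_isOneTwoHipster_le n).subset fun _ h => ⟨h.1.le, h.2⟩

/-- The finset of 1-2 hipster trees with `n` vertices. -/
noncomputable def hipsters (n : ℕ) : Finset PlaneTree := (finite_isOneTwoHipster n).toFinset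

theorem mem_hipsters {n : ℕ} {T : PlaneTree} :
    T ∈ hipsters n ↔ T.numVertices = n ∧ T.IsOneTwoHipster := by
  simp [hipsters]

/-- The number of nonempty 1-2 hipster trees with `n` vertices. -/
noncomputable def numHipsters (n : ℕ) : ℕ := (hipsters n).card

theorem numHipsters_zero : numHipsters 0 = 0 := by
  rw [numHipsters, Finset.card_eq_zero, Finset.eq_empty_iff_forall_notMem]
  intro T hT
  exact T.numVertices_pos.ne' (mem_hipsters.1 hT).1

-- The subtracted diagonal is moved to the left, which avoids truncated subtraction in `ℕ`.
open Finset in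
theorem numHipsters_succ (n : ℕ) :
    numHipsters (n + 1) + (if Even n then numHipsters (n / 2) else 0) =
      (if n = 0 then 1 else 0) + numHipsters n +
        ∑ p ∈ antidiagonal n, numHipsters p.1 * numHipsters p.2 := by
  classical
  set P := (antidiagonal n).biUnion fun p => hipsters p.1 ×ˢ hipsters p.2 with hPdef
  have hP : ∀ q : PlaneTree × PlaneTree, q ∈ P ↔ q.1.numVertices + q.2.numVertices = n ∧
      q.1.IsOneTwoHipster ∧ q.2.IsOneTwoHipster := by
    rintro ⟨A, B⟩
    simp only [hPdef, mem_biUnion, HasAntidiagonal.mem_antidiagonal, mem_product, mem_hipsters, Prod.exists]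
    constructor
    · rintro ⟨i, j, h, ⟨rfl, hA⟩, rfl, hB⟩
      exact ⟨h, hA, hB⟩
    · rintro ⟨h, hA, hB⟩
      exact ⟨_, _, h, ⟨rfl, hA⟩, rfl, hB⟩
  have hPcard : P.card = ∑ p ∈ antidiagonal n, numHipsters p.1 * numHipsters p.2 := by
    rw [hPdef, card_biUnion]
    · simp [numHipsters]
    · rintro ⟨i, j⟩ - ⟨k, l⟩ - h
      rw [Function.onFun, disjoint_left]
      rintro ⟨A, B⟩ h₁ h₂
      simp only [mem_product, mem_hipsters] at h₁ h₂
      apply h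
      rw [← h₁.1.1, ← h₁.2.1, ← h₂.1.1, ← h₂.2.1]
  have hdiag : (P.filter fun q => q.1 = q.2).card =
      if Even n then numHipsters (n / 2) else 0 := by
    split_ifs with hn
    · obtain ⟨k, rfl⟩ := hn
      rw [numHipsters, ← card_image_of_injective (hipsters ((k + k) / 2))
        (f := fun A => (A, A)) fun A B h => (Prod.ext_iff.1 h).1]
      congr 1
      ext ⟨A, B⟩
      simp only [mem_filter, hP, mem_image, mem_hipsters, Prod.mk.injEq]
      constructor
      · rintro ⟨⟨h, hA, -⟩, rfl⟩
        exact ⟨A, ⟨by omega, hA⟩, rfl, rfl⟩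
      · rintro ⟨A, ⟨h, hA⟩, rfl, rfl⟩
        exact ⟨⟨by omega, hA, hA⟩, rfl⟩
    · rw [card_eq_zero, filter_eq_empty_iff]
      rintro ⟨A, B⟩ hq (rfl : A = B)
      exact hn ⟨_, ((hP _).1 hq).1.symm⟩
  have hsplit := card_filter_add_card_filter_not (s := P) (fun q => q.1 = q.2)
  have hset : hipsters (n + 1) = ((if n = 0 then {node []} else ∅) ∪
      (hipsters n).image fun A => node [A]) ∪
      (P.filter fun q => ¬ q.1 = q.2).image fun q => node [q.1, q.2] := by
    ext T
    rw [mem_hipsters, isOneTwoHipster_iff]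
    simp only [mem_union, mem_image, mem_filter, hP, mem_hipsters, Prod.exists]
    constructor
    · rintro ⟨hn, rfl | ⟨A, hA, rfl⟩ | ⟨A, B, hA, hB, hAB, rfl⟩⟩
      · simp [numVertices_node] at hn
        simp [hn]
      · simp [numVertices_node] at hn
        exact .inl (.inr ⟨A, ⟨by omega, hA⟩, rfl⟩)
      · simp [numVertices_node] at hn
        exact .inr ⟨A, B, ⟨⟨by omega, hA, hB⟩, hAB⟩, rfl⟩
    · rintro ((h | ⟨A, ⟨h, hA⟩, rfl⟩) | ⟨A, B, ⟨⟨h, hA, hB⟩, hAB⟩, rfl⟩)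
      · split_ifs at h with hn
        · simp at h
          simp [h, hn, numVertices_node]
        · simp at h
      · refine ⟨?_, .inr (.inl ⟨A, hA, rfl⟩)⟩
        simp [numVertices_node]
        omega
      · refine ⟨?_, .inr (.inr ⟨A, B, hA, hB, hAB, rfl⟩)⟩
        simp [numVertices_node]
        omega
  have hcard : numHipsters (n + 1) = (if n = 0 then 1 else 0) + numHipsters n +
      (P.filter fun q => ¬ q.1 = q.2).card := by
    rw [numHipsters, hset, card_union_of_disjoint, card_union_of_disjoint,
      card_image_of_injective, card_image_of_injective]
    · split_ifs <;> simp [numHipsters]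
    · rintro ⟨A, B⟩ ⟨C, D⟩ h
      simpa using h
    · intro A B h
      simpa using h
    · rw [disjoint_left]
      split_ifs <;> simp
    · rw [disjoint_left]
      split_ifs <;> simp
  rw [hcard, ← hPcard, ← hdiag]
  omega

end PlaneTree

/-! ### The functional equation. -/

open PlaneTree

theorem hipsterCount_eq (n : ℕ) :
    hipsterCount n = (if n = 0 then 1 else 0) + numHipsters n := by
  cases n with
  | zero => simp [hipsterCount, numHipsters_zero]
  | succ n =>
    rw [hipsterCount, if_neg n.succ_ne_zero, zero_add, numHipsters, hipsters,
      ← Set.ncard_eq_toFinset_card _ (finite_isOneTwoHipster (n + 1))]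
    rfl

open PowerSeries in
theorem hipsterSeries_eq :
    hipsterSeries =
        PowerSeries.X *
            (hipsterSeries ^ 2 - hipsterSeries
              - PowerSeries.subst (PowerSeries.X ^ 2 : PowerSeries ℤ) hipsterSeries + 2) + 1 := by
  have hs : HasSubst (X ^ 2 : PowerSeries ℤ) := HasSubst.X_pow two_ne_zero
  set T : PowerSeries ℤ := PowerSeries.mk fun n => (numHipsters n : ℤ) with hT
  have hH : hipsterSeries = 1 + T := by
    ext n
    simp [hipsterSeries, hT, hipsterCount_eq, coeff_one]
  have key : T = X * (1 + T + T ^ 2 - subst (X ^ 2 : PowerSeries ℤ) T) := by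
    ext n
    cases n with
    | zero => simp [hT, numHipsters_zero]
    | succ n =>
      rw [coeff_succ_X_mul, map_sub, map_add, map_add, coeff_one, sq, coeff_mul,
        coeff_subst_X_pow two_ne_zero]
      have h := numHipsters_succ n
      zify at h
      simp only [hT, coeff_mk, ← even_iff_two_dvd]
      push_cast at h ⊢
      simp only [Nat.cast_eq_zero] at h
      linarith
  have h1 : subst (X ^ 2 : PowerSeries ℤ) (1 + T) = 1 + subst (X ^ 2 : PowerSeries ℤ) T := by
    rw [← coe_substAlgHom hs, map_add, map_one]
  rw [hH, h1]
  linear_combination key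

/-! ### Growth inequalities and partial sums. -/

namespace PlaneTree
open Finset

theorem le_sum_antidiagonal_numHipsters (m n : ℕ) :
    numHipsters m * numHipsters n ≤
      ∑ p ∈ antidiagonal (m + n), numHipsters p.1 * numHipsters p.2 :=
  single_le_sum (f := fun p : ℕ × ℕ => numHipsters p.1 * numHipsters p.2)
    (fun _ _ => Nat.zero_le _) (a := (m, n)) (by simp)

/-- For `n = 2k` the term `numHipsters k ^ 2` of the convolution absorbs the diagonal `numHipsters
k`. -/
theorem numHipsters_le_succ (n : ℕ) : numHipsters n ≤ numHipsters (n + 1) := by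
  have h := numHipsters_succ n
  rcases Nat.even_or_odd' n with ⟨k, rfl | rfl⟩
  · have h' := le_sum_antidiagonal_numHipsters k k
    have h'' := Nat.le_mul_self (numHipsters k)
    rw [← two_mul] at h'
    rw [if_pos (even_two_mul k), Nat.mul_div_cancel_left k two_pos] at h
    omega
  · rw [if_neg (by simp [parity_simps])] at h
    omega

theorem monotone_numHipsters : Monotone numHipsters :=
  monotone_nat_of_le_succ numHipsters_le_succ

theorem numHipsters_mul_le (m n : ℕ) :
    numHipsters m * numHipsters n ≤ numHipsters (m + n + 1) := by
  have h := numHipsters_succ (m + n)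
  have h' := le_sum_antidiagonal_numHipsters m n
  have h'' := monotone_numHipsters (Nat.div_le_self (m + n) 2)
  split_ifs at h <;> omega

theorem numHipsters_one : numHipsters 1 = 1 := by
  simpa [numHipsters_zero] using numHipsters_succ 0

theorem numHipsters_pos {n : ℕ} (hn : n ≠ 0) : 0 < numHipsters n :=
  (numHipsters_one.symm ▸ Nat.one_pos : 0 < numHipsters 1).trans_le
    (monotone_numHipsters (Nat.one_le_iff_ne_zero.2 hn))

/-- The partial sums of the generating function of nonempty 1-2 hipster trees. -/
noncomputable def partialSum (n : ℕ) (x : ℝ) : ℝ :=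
  ∑ k ∈ range (n + 1), (numHipsters k : ℝ) * x ^ k

theorem partialSum_zero (x : ℝ) : partialSum 0 x = 0 := by
  simp [partialSum, numHipsters_zero]

theorem partialSum_mono {x : ℝ} (hx : 0 ≤ x) : Monotone fun n => partialSum n x := by
  refine monotone_nat_of_le_succ fun n => ?_
  simp only [partialSum]
  rw [sum_range_succ _ (n + 1)]
  exact le_add_of_nonneg_right (by positivity)

theorem partialSum_nonneg (n : ℕ) {x : ℝ} (hx : 0 ≤ x) : 0 ≤ partialSum n x :=
  sum_nonneg fun _ _ => by positivity

/-- The partial sums of the square of the generating function. -/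
noncomputable def convSum (n : ℕ) (x : ℝ) : ℝ :=
  ∑ k ∈ range (n + 1), ∑ p ∈ antidiagonal k,
    ((numHipsters p.1 : ℝ) * x ^ p.1) * (numHipsters p.2 * x ^ p.2)

/-- With a triangle in place of antidiagonals, comparing `convSum` with squares of partial sums
becomes an inclusion of index sets. -/
theorem sum_range_sum_antidiagonal (N : ℕ) (f : ℕ × ℕ → ℝ) :
    ∑ k ∈ range N, ∑ p ∈ antidiagonal k, f p =
      ∑ p ∈ (range N ×ˢ range N).filter (fun p => p.1 + p.2 < N), f p := by
  rw [← sum_fiberwise_of_maps_to (g := fun p : ℕ × ℕ => p.1 + p.2) (t := range N) (by simp)]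
  refine sum_congr rfl fun k hk => sum_congr ?_ fun _ _ => rfl
  ext p
  simp only [HasAntidiagonal.mem_antidiagonal, mem_filter, mem_product, mem_range] at hk ⊢
  omega

theorem convSum_le (n : ℕ) {x : ℝ} (hx : 0 ≤ x) : convSum n x ≤ partialSum n x ^ 2 := by
  rw [sq, partialSum, sum_mul_sum, ← sum_product', convSum, sum_range_sum_antidiagonal]
  exact sum_le_sum_of_subset_of_nonneg (filter_subset _ _) fun _ _ _ => by positivity

theorem le_convSum (n : ℕ) {x : ℝ} (hx : 0 ≤ x) : partialSum n x ^ 2 ≤ convSum (2 * n) x := by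
  rw [sq, partialSum, sum_mul_sum, ← sum_product', convSum, sum_range_sum_antidiagonal]
  refine sum_le_sum_of_subset_of_nonneg (fun p hp => ?_) fun _ _ _ => by positivity
  simp only [mem_filter, mem_product, mem_range] at hp ⊢
  omega

theorem sum_even_eq (n : ℕ) (x : ℝ) :
    ∑ k ∈ range (n + 1), (if Even k then (numHipsters (k / 2) : ℝ) else 0) * x ^ k =
      partialSum (n / 2) (x ^ 2) := by
  have h : ∀ m : ℕ, ∑ k ∈ range (2 * m + 1),
      (if Even k then (numHipsters (k / 2) : ℝ) else 0) * x ^ k = partialSum m (x ^ 2) := by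
    intro m
    induction m with
    | zero => simp [partialSum]
    | succ m ih =>
      rw [show 2 * (m + 1) + 1 = 2 * m + 1 + 1 + 1 by ring, sum_range_succ, sum_range_succ, ih,
        partialSum, partialSum, sum_range_succ _ (m + 1), if_neg (by simp [parity_simps]),
        if_pos (by simp [parity_simps])]
      rw [show (2 * m + 1 + 1) / 2 = m + 1 by omega, ← pow_mul]
      ring
  rcases Nat.even_or_odd' n with ⟨m, rfl | rfl⟩
  · rw [h, show 2 * m / 2 = m by omega]
  · rw [sum_range_succ, h, if_neg (by simp [parity_simps]),
      show (2 * m + 1) / 2 = m by omega]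
    ring

theorem partialSum_succ (n : ℕ) (x : ℝ) :
    partialSum (n + 1) x = x * (1 + partialSum n x + convSum n x - partialSum (n / 2) (x ^ 2)) := by
  have h1 : ∑ k ∈ range (n + 1), (if k = 0 then (1 : ℝ) else 0) * x ^ k = 1 := by
    simp
  have h2 : partialSum (n + 1) x =
      x * ∑ k ∈ range (n + 1), (numHipsters (k + 1) : ℝ) * x ^ k := by
    rw [partialSum, sum_range_succ', numHipsters_zero, mul_sum]
    simp only [Nat.cast_zero, zero_mul, add_zero]
    exact sum_congr rfl fun k _ => by ring
  suffices h : ∑ k ∈ range (n + 1), (numHipsters (k + 1) : ℝ) * x ^ k =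
      ∑ k ∈ range (n + 1), (if k = 0 then (1 : ℝ) else 0) * x ^ k + partialSum n x +
        convSum n x - partialSum (n / 2) (x ^ 2) by rw [h2, h, h1]
  rw [← sum_even_eq, partialSum, convSum]
  rw [← sum_add_distrib, ← sum_add_distrib, ← sum_sub_distrib]
  refine sum_congr rfl fun k _ => ?_
  have h3 : ∑ p ∈ antidiagonal k, ((numHipsters p.1 : ℝ) * x ^ p.1) * (numHipsters p.2 * x ^ p.2) =
      (∑ p ∈ antidiagonal k, (numHipsters p.1 : ℝ) * numHipsters p.2) * x ^ k := by
    rw [sum_mul]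
    refine sum_congr rfl fun p hp => ?_
    rw [← HasAntidiagonal.mem_antidiagonal.1 hp]
    ring
  rw [h3]
  have h := congrArg (Nat.cast (R := ℝ)) (numHipsters_succ k)
  push_cast at h
  linear_combination x ^ k * h

end PlaneTree

/-! ### Numerical bounds and existence of the limit. -/

namespace PlaneTree
open Finset Filter Topology

/-- A majorant criterion for the partial sums. -/
theorem partialSum_le {x y : ℝ} (hx : 0 ≤ x) (k : ℕ)
    (hy : x * (1 + y + y ^ 2 - partialSum k (x ^ 2)) ≤ y) (h0 : partialSum (2 * k) x ≤ y) (n : ℕ) :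
    partialSum n x ≤ y := by
  rcases le_total n (2 * k) with hn | hn
  · exact (partialSum_mono hx hn).trans h0
  -- From `2 * k` on, `k ≤ n / 2`, so the truncation at `k` bounds the subtracted term from below.
  induction n, hn using Nat.le_induction with
  | base => exact h0
  | succ n hn ih =>
    refine le_trans ?_ hy
    rw [partialSum_succ]
    have h1 := convSum_le n hx
    have h2 := pow_le_pow_left₀ (partialSum_nonneg n hx) ih 2
    have h3 : partialSum k (x ^ 2) ≤ partialSum (n / 2) (x ^ 2) :=
      partialSum_mono (sq_nonneg x) (by omega)
    exact mul_le_mul_of_nonneg_left (by linarith) hx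

theorem le_partialSum {x τ : ℝ} (hx : 0 ≤ x) (n : ℕ) (hτ : partialSum n (x ^ 2) ≤ τ) :
    x * (1 + partialSum n x + partialSum n x ^ 2 - τ) ≤ partialSum (2 * n + 1) x := by
  rw [partialSum_succ, Nat.mul_div_cancel_left n two_pos]
  have h1 := le_convSum n hx
  have h2 : partialSum n x ≤ partialSum (2 * n) x := partialSum_mono hx (by omega)
  exact mul_le_mul_of_nonneg_left (by linarith) hx

/-- The majorant `0.927441 = (2.854882 - 1) / 2` minimises the quadratic. Truncating `T(x²)` at `k =
4` requires the counts up to `2k = 8`. -/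
theorem partialSum_inv_upper_le (n : ℕ) : partialSum n (2.854882 : ℝ)⁻¹ ≤ 0.927441 := by
  have h1 := numHipsters_one
  have h2 : numHipsters 2 = 1 := by
    simpa [Nat.antidiagonal_succ, h1, numHipsters_zero] using numHipsters_succ 1
  have h3 : numHipsters 3 = 1 := by
    have := numHipsters_succ 2
    simp [Nat.antidiagonal_succ, h1, h2, numHipsters_zero] at this
    omega
  have h4 : numHipsters 4 = 3 := by
    have := numHipsters_succ 3
    simp [Nat.antidiagonal_succ, h1, h2, h3, numHipsters_zero, parity_simps] at this
    omega
  have h5 : numHipsters 5 = 5 := by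
    have := numHipsters_succ 4
    simp [Nat.antidiagonal_succ, h1, h2, h3, h4, numHipsters_zero, parity_simps] at this
    omega
  have h6 : numHipsters 6 = 13 := by
    have := numHipsters_succ 5
    simp [Nat.antidiagonal_succ, h1, h2, h3, h4, h5, numHipsters_zero, parity_simps] at this
    omega
  have h7 : numHipsters 7 = 29 := by
    have := numHipsters_succ 6
    simp [Nat.antidiagonal_succ, h1, h2, h3, h4, h5, h6, numHipsters_zero, parity_simps] at this
    omega
  have h8 : numHipsters 8 = 71 := by
    have := numHipsters_succ 7
    simp [Nat.antidiagonal_succ, h1, h2, h3, h4, h5, h6, h7, numHipsters_zero,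
      parity_simps] at this
    omega
  refine partialSum_le (by norm_num) 4 ?_ ?_ n
  · simp only [partialSum, sum_range_succ, sum_range_zero, h1, h2, h3, h4, numHipsters_zero]
    norm_num
  · simp only [partialSum, sum_range_succ, sum_range_zero, h1, h2, h3, h4, h5, h6, h7, h8,
      numHipsters_zero]
    norm_num

/-- With `k = 0` the subtracted term is dropped altogether. Any bound below `1 - 0.912243² ≈ 0.1678`
would serve the divergence argument. -/
theorem partialSum_inv_lower_sq_le (n : ℕ) : partialSum n ((2.824486 : ℝ)⁻¹ ^ 2) ≤ 0.16 :=
  partialSum_le (by positivity) 0 (by rw [partialSum_zero]; norm_num)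
    (by rw [partialSum_zero]; norm_num) n

theorem not_summable_numHipsters :
    ¬ Summable fun n => (numHipsters n : ℝ) * (2.824486 : ℝ)⁻¹ ^ n := by
  intro hs
  obtain ⟨L, hL⟩ := hs
  have h1 : Tendsto (fun n => partialSum n (2.824486 : ℝ)⁻¹) atTop (𝓝 L) :=
    hL.tendsto_sum_nat.comp (tendsto_add_atTop_nat 1)
  have h2 : Tendsto (fun n => partialSum (2 * n + 1) (2.824486 : ℝ)⁻¹) atTop (𝓝 L) :=
    h1.comp (tendsto_atTop_mono (fun n => by simp; omega) tendsto_id)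
  have h3 := le_of_tendsto_of_tendsto' ((((h1.const_add 1).add (h1.pow 2)).sub_const 0.16).const_mul
    (2.824486 : ℝ)⁻¹) h2
    fun n => le_partialSum (by norm_num) n (partialSum_inv_lower_sq_le n)
  norm_num at h3
  -- The limit inequality is `L² - 1.824486 L + 0.84 ≤ 0`, whose discriminant is negative;
  -- `0.912243` is the vertex.
  nlinarith [sq_nonneg (L - 0.912243)]

theorem numHipsters_le_pow (n : ℕ) : (numHipsters n : ℝ) ≤ 2.854882 ^ n := by
  have h : (numHipsters n : ℝ) * (2.854882 : ℝ)⁻¹ ^ n ≤ partialSum n (2.854882 : ℝ)⁻¹ :=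
    single_le_sum (f := fun k => (numHipsters k : ℝ) * (2.854882 : ℝ)⁻¹ ^ k)
      (fun _ _ => by positivity) (self_mem_range_succ n)
  have h' : (numHipsters n : ℝ) * (2.854882 : ℝ)⁻¹ ^ n ≤ 1 :=
    h.trans ((partialSum_inv_upper_le n).trans (by norm_num))
  rwa [inv_pow, ← div_eq_mul_inv, div_le_one (by positivity)] at h'

/-- The shift to `n - 1` absorbs the root vertex in `numHipsters_mul_le`. For `n ≤ 1` the convention
`Real.log 0 = 0` reduces the claim to monotonicity. -/
theorem subadditive_neg_log_numHipsters :
    Subadditive fun n => -Real.log (numHipsters (n - 1)) := by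
  have hmono : ∀ m n : ℕ, Real.log (numHipsters (n - 1)) ≤ Real.log (numHipsters (m + n - 1)) := by
    intro m n
    rcases Nat.lt_or_ge 1 n with hn | hn
    · exact Real.log_le_log (by exact_mod_cast numHipsters_pos (by omega))
        (by exact_mod_cast monotone_numHipsters (by omega))
    · rw [Nat.sub_eq_zero_of_le hn, numHipsters_zero, Nat.cast_zero, Real.log_zero]
      exact Real.log_natCast_nonneg _
  intro m n
  rcases Nat.lt_or_ge 1 m with hm | hm
  · rcases Nat.lt_or_ge 1 n with hn | hn
    · have hm' : (0 : ℝ) < numHipsters (m - 1) := by exact_mod_cast numHipsters_pos (by omega)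
      have hn' : (0 : ℝ) < numHipsters (n - 1) := by exact_mod_cast numHipsters_pos (by omega)
      have h := numHipsters_mul_le (m - 1) (n - 1)
      rw [show m - 1 + (n - 1) + 1 = m + n - 1 by omega] at h
      have h' := Real.log_le_log (mul_pos hm' hn')
        (y := (numHipsters (m + n - 1) : ℝ)) (by exact_mod_cast h)
      rw [Real.log_mul hm'.ne' hn'.ne'] at h'
      linarith
    · have h := hmono n m
      rw [add_comm] at h
      simp only [Nat.sub_eq_zero_of_le hn, numHipsters_zero, Nat.cast_zero, Real.log_zero]
      linarith
  · have h := hmono m n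
    simp only [Nat.sub_eq_zero_of_le hm, numHipsters_zero, Nat.cast_zero, Real.log_zero]
    linarith

theorem exists_tendsto_numHipsters_rpow :
    ∃ ρ : ℝ, Tendsto (fun n : ℕ => (numHipsters n : ℝ) ^ (1 / (n : ℝ))) atTop (𝓝 ρ) := by
  have hlog : ∀ n : ℕ, Real.log (numHipsters n) ≤ n * Real.log 2.854882 := by
    intro n
    rcases eq_or_ne n 0 with rfl | hn
    · simp [numHipsters_zero]
    · rw [← Real.log_pow]
      exact Real.log_le_log (by exact_mod_cast numHipsters_pos hn) (numHipsters_le_pow n)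
  have hlog0 : 0 ≤ Real.log 2.854882 := Real.log_nonneg (by norm_num)
  have hbdd : BddBelow (Set.range fun n : ℕ => -Real.log (numHipsters (n - 1)) / (n : ℝ)) := by
    refine ⟨-Real.log 2.854882, ?_⟩
    rintro _ ⟨n, rfl⟩
    rcases Nat.eq_zero_or_pos n with rfl | hn
    · simpa using hlog0
    · have hn' : (0 : ℝ) < n := by exact_mod_cast hn
      simp only [neg_div, neg_le_neg_iff]
      rw [div_le_iff₀ hn', mul_comm]
      refine (hlog _).trans (mul_le_mul_of_nonneg_right ?_ hlog0)
      exact_mod_cast Nat.sub_le n 1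
  have h1 := ((subadditive_neg_log_numHipsters.tendsto_lim hbdd).comp
    (tendsto_add_atTop_nat 1)).neg
  have h2 : Tendsto (fun n : ℕ => ((n : ℝ) + 1) / n) atTop (𝓝 1) := by
    have := (tendsto_one_div_atTop_nhds_zero_nat (𝕜 := ℝ)).const_add 1
    rw [add_zero] at this
    refine this.congr' ?_
    filter_upwards [eventually_ne_atTop 0] with n hn
    field_simp
  -- Fekete's lemma normalises by `n + 1`; the factor `(n + 1) / n` restores `n`.
  refine ⟨_, ((Real.continuous_exp.tendsto _).comp (h1.mul h2)).congr' ?_⟩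
  filter_upwards [eventually_ne_atTop 0] with n hn
  have hn' : (n : ℝ) + 1 ≠ 0 := by positivity
  rw [Real.rpow_def_of_pos (by exact_mod_cast numHipsters_pos hn)]
  simp only [Function.comp_apply, Nat.add_sub_cancel]
  congr 1
  push_cast
  field_simp

end PlaneTree

open Filter in
theorem mainTheorem2 :
    hipsterSeries =
        PowerSeries.X *
            (hipsterSeries ^ 2 - hipsterSeries
              - PowerSeries.subst (PowerSeries.X ^ 2 : PowerSeries ℤ) hipsterSeries + 2) + 1 ∧
      ∃ ρ : ℝ,
        Filter.Tendsto (fun n : ℕ => (hipsterCount n : ℝ) ^ (1 / (n : ℝ))) Filter.atTop (nhds ρ) ∧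
          ρ ∈ Set.Icc (2.824486 : ℝ) 2.854882 := by
  refine ⟨hipsterSeries_eq, ?_⟩
  obtain ⟨ρ, hρ⟩ := exists_tendsto_numHipsters_rpow
  have hpow : ∀ n : ℕ, n ≠ 0 →
      ((numHipsters n : ℝ) ^ (1 / (n : ℝ))) ^ n = numHipsters n := fun n hn => by
    rw [one_div, Real.rpow_inv_natCast_pow (Nat.cast_nonneg _) hn]
  refine ⟨ρ, hρ.congr' ?_, ?_, ?_⟩
  · filter_upwards [eventually_ne_atTop 0] with n hn
    rw [hipsterCount_eq, if_neg hn, zero_add]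
  -- A smaller `ρ` would give summability at `1/2.824486` by comparison with a geometric series.
  · by_contra! hlt
    obtain ⟨r, hr, hr'⟩ := exists_between hlt
    have hr0 : 0 ≤ r := (ge_of_tendsto' hρ fun n => by positivity).trans hr.le
    refine not_summable_numHipsters (.of_norm_bounded_eventually_nat
      (g := fun n => (r * (2.824486 : ℝ)⁻¹) ^ n) (summable_geometric_of_lt_one (by positivity) ?_) ?_)
    · rwa [← div_eq_mul_inv, div_lt_one (by norm_num)]
    · filter_upwards [hρ.eventually_lt_const hr, eventually_ne_atTop 0] with n hn hn0
      rw [Real.norm_of_nonneg (by positivity), mul_pow]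
      refine mul_le_mul_of_nonneg_right ?_ (by positivity)
      rw [← hpow n hn0]
      exact pow_le_pow_left₀ (by positivity) hn.le n
  · refine le_of_tendsto hρ ?_
    filter_upwards [eventually_ne_atTop 0] with n hn
    refine le_of_pow_le_pow_left₀ hn (by norm_num) ?_
    rw [hpow n hn]
    exact numHipsters_le_pow n
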